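/- Let $\mathcal A$ be a unital C*-algebra and let $\mathcal V$ be an operator system in $\mathcal A$, that is, a closed linear subspace of $\mathcal A$ that is stable under the involution and contains the identity element of $\mathcal A$. For each natural number $n$ equip $M_n(\mathcal A)$ with its unique C*-norm, identify $M_n(\mathcal A/\mathcal V)$ with $M_n(\mathcal A)/M_n(\mathcal V)$ and give it the corresponding quotient norm; give $\mathcal A/\mathcal V$ the involution $(A+\mathcal V)^*=A^*+\mathcal V$. For a Hilbert space $\mathcal H$ let $\mathcal L(\mathcal H)$ be the C*-algebra of bounded operators on $\mathcal H$, and let each $M_n(\mathcal L(\mathcal H))$ carry its C*-norm. Then there exist a Hilbert space $\mathcal H$, a unital $*$-representation $\pi:\mathcal A\to\mathcal L(\mathcal H)$, an orthogonal projection $P\in\mathcal L(\mathcal H)$, and an operator $Z\in\mathcal L(\mathcal H)$ with $$Z^*=-Z,\qquad \|Z\|\le 1,\qquad PZ=Z(I-P),$$ such that the linear map $\Psi:\mathcal A\to\mathcal L(\mathcal H)$ defined by $$\Psi(A)=\tfrac12\,P\,[Z,\pi(A)]\,P,\qquad [Z,\pi(A)]=Z\pi(A)-\pi(A)Z,$$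 is a $*$-map (that is, $\Psi(A^*)=\Psi(A)^*$ for all $A\in\mathcal A$), vanishes on $\mathcal V$, and induces a completely isometric $*$-map from $\mathcal A/\mathcal V$ onto a $*$-subspace of $\mathcal L(\mathcal H)$: if $\varphi:\mathcal A/\mathcal V\to\mathcal L(\mathcal H)$ is the induced linear map, then $\varphi$ is a $*$-map, its range is stable under the involution, and for every $n$ the map $M_n(\mathcal A/\mathcal V)\to M_n(\mathcal L(\mathcal H))$ that applies $\varphi$ to each entry is isometric. -/

import Mathlib

universe u v

/-- A family of real-valued functions, the `n`-th one on the space `M_n(W)` of `n × n` matrices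
with entries in `W`: the data of the norms on all the matrix spaces over `W`. -/
def MatrixNorm (W : Type u) : Type u :=
  ∀ n : ℕ, Matrix (Fin n) (Fin n) W → ℝ

/-- The matrix norm of a C*-algebra `A`: on each `M_n(A)` the (unique) C*-norm, for which
`CStarMatrix (Fin n) (Fin n) A` is a C*-algebra in Mathlib. (Mathlib asks for an order on `A` here;
we give it the canonical order of a C*-algebra.) -/
noncomputable def cstarMatrixNorm (A : Type u) [CStarAlgebra A] : MatrixNorm A :=
  letI := CStarAlgebra.spectralOrder A
  letI := CStarAlgebra.spectralOrderedRing A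
  fun n C => ‖(CStarMatrix.ofMatrix C : CStarMatrix (Fin n) (Fin n) A)‖

/-- The quotient matrix norm on `W ⧸ V`: a matrix over `W ⧸ V` is a coset of `M_n(V)` in `M_n(W)`,
and its norm is the infimum of the norms of the elements `C` of that coset. -/
noncomputable def MatrixNorm.quotient {W : Type u} [AddCommGroup W] [Module ℂ W]
    (ν : MatrixNorm W) (V : Submodule ℂ W) : MatrixNorm (W ⧸ V) :=
  fun n X => sInf {r : ℝ | ∃ C : Matrix (Fin n) (Fin n) W, C.map V.mkQ = X ∧ ν n C = r}

/-- A linear map `φ` is a complete isometry if for every `n` its entrywise application `φ_n` is an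
isometry for the norms on the `n × n` matrices. -/
def IsCompleteIsometry {W : Type u} {X : Type v} [AddCommGroup W] [Module ℂ W]
    [AddCommGroup X] [Module ℂ X] (ν : MatrixNorm W) (μ : MatrixNorm X) (φ : W →ₗ[ℂ] X) : Prop :=
  ∀ (n : ℕ) (C : Matrix (Fin n) (Fin n) W), μ n (C.map φ) = ν n C

/-- An operator system in a unital C*-algebra: a closed `*`-subspace that contains the identity
element. -/
structure OperatorSystem (A : Type u) [CStarAlgebra A] extends Submodule ℂ A where
  isClosed' : IsClosed carrier
  star_mem' : ∀ {a : A}, a ∈ carrier → star a ∈ carrier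
  one_mem' : (1 : A) ∈ carrier

namespace OperatorSystem

variable {A : Type u} [CStarAlgebra A]

/-- The quotient vector space `A/V`. -/
abbrev Quotient (V : OperatorSystem A) : Type u := A ⧸ V.toSubmodule

/-- The involution on `A/V` induced by that of `A`: the class of `a` goes to the class of `a*`. -/
noncomputable instance instStarQuotient (V : OperatorSystem A) : Star V.Quotient where
  star := Quotient.lift (fun a : A => V.toSubmodule.mkQ (star a)) (by
    intro a b hab
    have h : a - b ∈ V.toSubmodule := (Submodule.quotientRel_def V.toSubmodule).1 hab
    refine (Submodule.Quotient.eq V.toSubmodule).2 ?_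
    rw [← star_sub]
    exact V.star_mem' h)

@[simp] theorem star_mkQ (V : OperatorSystem A) (a : A) :
    star (V.toSubmodule.mkQ a : V.Quotient) = V.toSubmodule.mkQ (star a) := rfl

/-- `A/V` is a vector `*`-space: its star is an additive involution (and, by the next instance,
conjugate linear). -/
noncomputable instance instStarAddMonoidQuotient (V : OperatorSystem A) : StarAddMonoid V.Quotient where
  star_involutive x := by
    obtain ⟨a, rfl⟩ := V.toSubmodule.mkQ_surjective x
    rw [star_mkQ, star_mkQ, star_star]
  star_add x y := by
    obtain ⟨a, rfl⟩ := V.toSubmodule.mkQ_surjective x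
    obtain ⟨b, rfl⟩ := V.toSubmodule.mkQ_surjective y
    rw [← map_add, star_mkQ, star_mkQ, star_mkQ, star_add, map_add]

instance instStarModuleQuotient (V : OperatorSystem A) : StarModule ℂ V.Quotient where
  star_smul c x := by
    obtain ⟨a, rfl⟩ := V.toSubmodule.mkQ_surjective x
    rw [← map_smul, star_mkQ, star_mkQ, star_smul, map_smul]

/-- The quotient matrix norm on `A/V`. -/
noncomputable def quotientMatrixNorm (V : OperatorSystem A) : MatrixNorm V.Quotient :=
  (cstarMatrixNorm A).quotient V.toSubmodule

end OperatorSystem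

/-- The linear map `Ψ(a) = (1/2) P [Z, π(a)] P` from `A` to the bounded operators on `H`. -/
noncomputable def commutatorCompression {A : Type u} [CStarAlgebra A] {H : Type v}
    [NormedAddCommGroup H] [InnerProductSpace ℂ H] [CompleteSpace H]
    (π : A →⋆ₐ[ℂ] (H →L[ℂ] H)) (P Z : H →L[ℂ] H) : A →ₗ[ℂ] (H →L[ℂ] H) where
  toFun a := (1 / 2 : ℂ) • (P * (Z * π a - π a * Z) * P)
  map_add' a b := by
    rw [← smul_add]
    congr 1
    rw [map_add]
    noncomm_ring
  map_smul' c a := by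
    simp only [map_smul, mul_smul_comm, smul_mul_assoc, ← smul_sub, RingHom.id_apply]
    rw [smul_comm]

/-! The upper bound holds for any such data: entrywise, `Ψ` is `C ↦ ½ p [z, π(C)] p` with `p`, `z`
diagonal contractions, so it is contractive; vanishing on `V`, it is contractive for the quotient
norm. It remains to norm each matrix from below, one at a time, and to add up the resulting
compressions on a Hilbert sum.

Let `C` have quotient norm `d > 0`. The self-adjoint `D` with corners `C`, `C*` in `B = M₂(Mₙ(A))`
has distance at least `d` from the matrices over `V`. In `B × B`, the real span of `(D, -D) - d·1`
and of all `(s, -s)` with `s` over `V` misses the open unit ball around `1`. Hahn–Banach then gives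
a positive functional `g` with `g(s, -s) = 0` and `Re g(D, -D) = d · Re g(1)`
(`exists_positive_functional_of_dist`).

In the GNS space of `g`, `J = (1, -1)` acts as a symmetry commuting with `A`. Let `P` project onto
the span of the vectors given by matrix units. Then `P J π(a) P = 0` for `a ∈ V`; since `1 ∈ V`,
also `PJP = 0`. This makes `Z = PJ - JP` admissible and gives `½ P[Z, π(a)]P = P J π(a) P`, whose
matrix coefficients are the values of `g`; so the value at `(D, -D)` norms `C`. -/

/-! ### Separation by a positive functional -/

/-- A real functional that is positive on the unit ball around `1` is nonnegative on positive
elements. -/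
theorem nonneg_of_pos_on_ball {C : Type u} [CStarAlgebra C] (φ : C →L[ℝ] ℝ)
    (hφ : ∀ a, ‖a - 1‖ < 1 → 0 < φ a) (x : C) : 0 ≤ φ (star x * x) := by
  let := CStarAlgebra.spectralOrder C
  have := CStarAlgebra.spectralOrderedRing C
  set a := star x * x with ha
  have ha0 : 0 ≤ a := star_mul_self_nonneg x
  have hsa : IsSelfAdjoint a := IsSelfAdjoint.of_nonneg ha0
  have h1 : 0 < φ 1 := hφ 1 (by simp)
  have hna : ‖algebraMap ℝ C ‖a‖ - a‖ ≤ ‖a‖ :=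
    (CStarAlgebra.mem_Icc_algebraMap_iff_norm_le (norm_nonneg a)).1
      ⟨sub_nonneg.2 hsa.le_algebraMap_norm_self, sub_le_self _ ha0⟩ |>.2
  by_contra! hneg
  -- Chosen so that `φ (a + ε • 1) = 0`, although a positive multiple of `a + ε • 1` lies in the
  -- ball.
  set ε := -φ a / φ 1 with hε
  have hε0 : 0 < ε := div_pos (neg_pos.2 hneg) h1
  set r := ‖a‖ + ε with hr
  have hr0 : 0 < r := by positivity
  have key : r⁻¹ • (a + ε • (1 : C)) - 1 = -(r⁻¹ • (algebraMap ℝ C ‖a‖ - a)) := by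
    have : (1 : C) = r⁻¹ • (r • (1 : C)) := by rw [smul_smul, inv_mul_cancel₀ hr0.ne', one_smul]
    rw [this, ← smul_sub, ← smul_neg, ← this, Algebra.algebraMap_eq_smul_one, hr, add_smul]
    congr 1
    abel
  have h2 := hφ (r⁻¹ • (a + ε • (1 : C))) (by
    rw [key, norm_neg, norm_smul, norm_inv, Real.norm_of_nonneg hr0.le, inv_mul_lt_iff₀ hr0]
    linarith)
  rw [map_smul, map_add, map_smul, smul_eq_mul, smul_eq_mul, hε, div_mul_cancel₀ _ h1.ne'] at h2
  simp at h2

/-- Some spectral point `l` of `y` has `|l| = ‖y‖`; then `c + l` and `c - l` lie in the spectra of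
`c + y` and `c - y`, and one of them has modulus `|c| + |l|`. -/
theorem abs_add_norm_le_of_isSelfAdjoint {B : Type u} [CStarAlgebra B] [Nontrivial B] {y : B}
    (hy : IsSelfAdjoint y) (c : ℝ) :
    |c| + ‖y‖ ≤ max ‖algebraMap ℝ B c + y‖ ‖algebraMap ℝ B c - y‖ := by
  obtain ⟨l, hl, hly⟩ : ∃ l ∈ spectrum ℝ y, |l| = ‖y‖ := by
    rcases CStarAlgebra.norm_or_neg_norm_mem_spectrum hy with h | h
    · exact ⟨_, h, by simp⟩
    · exact ⟨_, h, by simp⟩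
  have h1 : c + l ∈ spectrum ℝ (algebraMap ℝ B c + y) := by
    rw [← spectrum.singleton_add_eq]
    exact ⟨c, rfl, l, hl, rfl⟩
  have h2 : c - l ∈ spectrum ℝ (algebraMap ℝ B c - y) := by
    rw [← spectrum.singleton_sub_eq]
    exact ⟨c, rfl, l, hl, rfl⟩
  have h3 := spectrum.norm_le_norm_of_mem h1
  have h4 := spectrum.norm_le_norm_of_mem h2
  rw [← hly]
  rw [Real.norm_eq_abs] at h3 h4
  refine le_trans ?_ (max_le_max h3 h4)
  rcases abs_cases c with ⟨e, _⟩ | ⟨e, _⟩ <;> rcases abs_cases l with ⟨f, _⟩ | ⟨f, _⟩ <;>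
    rw [e, f, le_max_iff] <;>
    first
    | exact Or.inl (by linarith [le_abs_self (c + l)])
    | exact Or.inl (by linarith [neg_le_abs (c + l)])
    | exact Or.inr (by linarith [le_abs_self (c - l)])
    | exact Or.inr (by linarith [neg_le_abs (c - l)])

/-- If the self-adjoint `D` has distance at least `d` from the `*`-subspace `S` (uniformly along the
real line through `D`), some nonzero positive functional `g` on `B × B` has its two halves equal
on `S` and separated by `d` at `D`. -/
theorem exists_positive_functional_of_dist {B : Type u} [CStarAlgebra B] (S : Submodule ℂ B)
    (hS : ∀ s ∈ S, star s ∈ S) {D : B} (hD : IsSelfAdjoint D) {d : ℝ} (hd : 0 < d)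
    (hdist : ∀ t : ℝ, ∀ s ∈ S, |t| * d ≤ ‖t • D + s‖) :
    ∃ g : B × B →ₗ[ℂ] ℂ, (∀ x, 0 ≤ (g (star x * x)).re ∧ (g (star x * x)).im = 0) ∧
      0 < (g 1).re ∧ (∀ s ∈ S, g (s, -s) = 0) ∧ (g (D, -D)).re = d * (g 1).re := by
  have : Nontrivial B := by
    refine ⟨D, 0, fun h => ?_⟩
    have := hdist 1 0 S.zero_mem
    simp [h] at this
    linarith
  -- A functional killing `n₀` takes the value `d * f 1` at `(D, -D)`.
  let n₀ : B × B := (D, -D) - d • 1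
  let δ : B →ₗ[ℝ] B × B := LinearMap.prod LinearMap.id (-LinearMap.id)
  let N : Submodule ℝ (B × B) := Submodule.span ℝ {n₀} ⊔ (S.restrictScalars ℝ).map δ
  have hdisj : Disjoint (Metric.ball (1 : B × B) 1) (N : Set (B × B)) := by
    rw [Set.disjoint_left]
    intro z hz hzN
    obtain ⟨y, hy, w, ⟨s, hs, rfl⟩, rfl⟩ := Submodule.mem_sup.1 hzN
    obtain ⟨t, rfl⟩ := Submodule.mem_span_singleton.1 hy
    rw [mem_ball_iff_norm, Prod.norm_def, max_lt_iff] at hz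
    -- The self-adjoint parts of the coordinates of `z - 1` are `y - c` and `-(y + c)`. Both having
    -- norm below `1` forces `|c| + ‖y‖ < 1`, against `|1 + t d| + |t| d ≥ 1`.
    set c : ℝ := 1 + t * d with hc
    set y : B := t • D + (2⁻¹ : ℝ) • (s + star s) with hy
    have hsS : (2⁻¹ : ℝ) • (s + star s) ∈ S :=
      (S.restrictScalars ℝ).smul_mem _ (S.add_mem hs (hS s hs))
    have hysa : IsSelfAdjoint y := by
      refine (IsSelfAdjoint.smul (star_trivial t) hD).add
        (IsSelfAdjoint.smul (star_trivial _) ?_)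
      exact IsSelfAdjoint.add_star_self s
    have half : ∀ x : B, ‖(2⁻¹ : ℝ) • (x + star x)‖ ≤ ‖x‖ := fun x => by
      rw [norm_smul, Real.norm_of_nonneg (by norm_num)]
      have := norm_add_le x (star x)
      rw [norm_star] at this
      linarith
    have e1 : ‖algebraMap ℝ B c - y‖ < 1 := by
      refine lt_of_le_of_lt (le_of_eq_of_le ?_ (half _)) hz.1
      rw [← norm_neg, hy]
      congr 1
      simp [n₀, δ, hc, Algebra.algebraMap_eq_smul_one, hD.star_eq]
      module
    have e2 : ‖algebraMap ℝ B c + y‖ < 1 := by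
      refine lt_of_le_of_lt (le_of_eq_of_le ?_ (half _)) hz.2
      rw [← norm_neg, hy]
      congr 1
      simp [n₀, δ, hc, Algebra.algebraMap_eq_smul_one, hD.star_eq]
      module
    have e3 := (abs_add_norm_le_of_isSelfAdjoint hysa c).trans_lt (max_lt e2 e1)
    have e4 : |t| * d ≤ ‖y‖ := hdist t _ hsS
    have e5 : |t| * d = |t * d| := by rw [abs_mul, abs_of_pos hd]
    have e6 : (1 : ℝ) ≤ |c| + |t * d| := by
      have := abs_sub c (t * d)
      have e : c - t * d = 1 := by rw [hc]; ring
      rwa [e, abs_one] at this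
    linarith
  obtain ⟨f, w, hf1, hf2⟩ := geometric_hahn_banach_open (convex_ball (1 : B × B) 1)
    Metric.isOpen_ball N.convex hdisj
  have hw : w ≤ 0 := by simpa using hf2 0 N.zero_mem
  have hN : ∀ b ∈ N, f b = 0 := by
    intro b hb
    by_contra hne
    have := hf2 _ (N.smul_mem ((w - 1) / f b) hb)
    rw [map_smul, smul_eq_mul, div_mul_cancel₀ _ hne] at this
    linarith
  have hpos : ∀ a : B × B, ‖a - 1‖ < 1 → 0 < (-f) a := fun a ha => by
    have := hf1 a (mem_ball_iff_norm.2 ha)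
    simp only [neg_apply, Left.neg_pos_iff]
    linarith
  -- Symmetrising `-f` under the involution makes the complex extension real on self-adjoint
  -- elements.
  let φ : Module.Dual ℝ (B × B) :=
    (-f : B × B →L[ℝ] ℝ).toLinearMap ∘ₗ (LinearMap.id + (starLinearEquiv ℝ).toLinearMap)
  have hφ : ∀ a, φ a = -f a - f (star a) := fun a => by simp [φ]; ring
  have hre : ∀ a, (φ.extendRCLike (𝕜 := ℂ) a).re = φ a :=
    φ.re_extendRCLike_apply (𝕜 := ℂ)
  have him : ∀ a, (φ.extendRCLike (𝕜 := ℂ) a).im = -φ (Complex.I • a) :=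
    φ.im_extendRCLike_apply (𝕜 := ℂ)
  have hSN : ∀ s ∈ S, f (s, -s) = 0 := fun s hs =>
    hN _ (Submodule.mem_sup_right ⟨s, hs, by simp [δ]⟩)
  have hφS : ∀ s ∈ S, φ (s, -s) = 0 := fun s hs => by
    rw [hφ, Prod.star_def, star_neg, hSN s hs, hSN _ (hS s hs)]
    simp
  refine ⟨φ.extendRCLike, fun x => ⟨?_, ?_⟩, ?_, fun s hs => ?_, ?_⟩
  · have := nonneg_of_pos_on_ball (-f) hpos x
    rw [hre, hφ, star_mul, star_star]
    rw [neg_apply] at this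
    linarith
  · rw [him, hφ, star_smul, star_mul, star_star, Complex.star_def, Complex.conj_I, neg_smul,
      map_neg]
    ring
  · have := hpos 1 (by simp)
    rw [hre, hφ, star_one]
    rw [neg_apply] at this
    linarith
  · apply Complex.ext
    · rw [hre, hφS s hs, Complex.zero_re]
    · rw [him, Prod.smul_mk, smul_neg, hφS _ (S.smul_mem _ hs), neg_zero, Complex.zero_im]
  · have h0 : f n₀ = 0 := hN _ (Submodule.mem_sup_left (Submodule.mem_span_singleton_self _))
    have h1 : f (D, -D) = d * f 1 := by
      rwa [map_sub, map_smul, smul_eq_mul, sub_eq_zero] at h0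
    rw [hre, hre, hφ, hφ, star_one, Prod.star_def, star_neg, hD.star_eq, h1]
    ring

/-! ### Sums of the form `∑ eᵢ* ρ(aᵢⱼ) eⱼ` -/

section Sandwich

variable {A : Type u} [CStarAlgebra A] {B : Type v} [CStarAlgebra B] {ι : Type*} [Fintype ι]

/-- The map `(aᵢⱼ) ↦ ∑ᵢⱼ eᵢ* ρ(aᵢⱼ) eⱼ`. -/
def sandwich (ρ : A →⋆ₐ[ℂ] B) (e : ι → B) : (ι → ι → A) →ₗ[ℂ] B where
  toFun c := ∑ i, ∑ j, star (e i) * ρ (c i j) * e j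
  map_add' c c' := by
    simp only [Pi.add_apply, map_add, mul_add, add_mul, Finset.sum_add_distrib]
  map_smul' z c := by
    simp only [Pi.smul_apply, map_smul, mul_smul_comm, smul_mul_assoc, Finset.smul_sum,
      RingHom.id_apply]

theorem sandwich_apply (ρ : A →⋆ₐ[ℂ] B) (e : ι → B) (c : ι → ι → A) :
    sandwich ρ e c = ∑ i, ∑ j, star (e i) * ρ (c i j) * e j := rfl

theorem sandwich_single [DecidableEq ι] (ρ : A →⋆ₐ[ℂ] B) (e : ι → B) (i j : ι) (a : A) :
    sandwich ρ e (Pi.single i (Pi.single j a)) = star (e i) * ρ a * e j := by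
  rw [sandwich_apply, Finset.sum_eq_single i, Finset.sum_eq_single j]
  · simp
  · intro k _ hk
    simp [Pi.single_eq_of_ne hk]
  · simp
  · intro k _ hk
    simp [Pi.single_eq_of_ne hk]
  · simp

theorem star_sandwich (ρ : A →⋆ₐ[ℂ] B) (e : ι → B) (c : ι → ι → A) :
    star (sandwich ρ e c) = sandwich ρ e (fun i j => star (c j i)) := by
  simp only [sandwich_apply, star_sum, star_mul, star_star, map_star, mul_assoc]
  exact Finset.sum_comm

end Sandwich

/-! ### GNS representation and compression to a span -/

open scoped ComplexOrder in
/-- The GNS representation of a positive functional, with the canonical map from the algebra. -/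
theorem exists_gns_representation {C : Type u} [CStarAlgebra C] (g : C →ₗ[ℂ] ℂ)
    (hg : ∀ x, 0 ≤ (g (star x * x)).re ∧ (g (star x * x)).im = 0) :
    ∃ (H : Type u) (_ : NormedAddCommGroup H) (_ : InnerProductSpace ℂ H) (_ : CompleteSpace H)
      (π : C →⋆ₐ[ℂ] (H →L[ℂ] H)) (η : C → H),
      (∀ x y, inner ℂ (η x) (η y) = g (star x * y)) ∧ ∀ a x, π a (η x) = η (a * x) := by
  let := CStarAlgebra.spectralOrder C
  have := CStarAlgebra.spectralOrderedRing C
  let f : C →ₚ[ℂ] ℂ := PositiveLinearMap.mk₀ g fun x hx => by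
    obtain ⟨y, rfl⟩ := CStarAlgebra.nonneg_iff_eq_star_mul_self.1 hx
    exact Complex.le_def.2 ⟨(hg y).1, (hg y).2.symm⟩
  refine ⟨f.GNS, inferInstance, inferInstance, inferInstance, f.gnsStarAlgHom,
    fun x => (f.toPreGNS x : f.GNS), fun x y => ?_, fun a x => ?_⟩
  · rw [UniformSpace.Completion.inner_coe]
    rfl
  · rw [PositiveLinearMap.gnsStarAlgHom_apply]
    exact f.gnsNonUnitalStarAlgHom_apply_coe

theorem starProjection_span_mul_mul_eq_zero {H : Type v} [NormedAddCommGroup H]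
    [InnerProductSpace ℂ H] {ι : Type*} (w : ι → H)
    [(Submodule.span ℂ (Set.range w)).HasOrthogonalProjection] (T : H →L[ℂ] H)
    (hT : ∀ i j, inner ℂ (w i) (T (w j)) = 0) :
    (Submodule.span ℂ (Set.range w)).starProjection * T *
      (Submodule.span ℂ (Set.range w)).starProjection = 0 := by
  set U := Submodule.span ℂ (Set.range w) with hU
  ext x
  change U.starProjection (T (U.starProjection x)) = 0
  rw [Submodule.starProjection_apply_eq_zero_iff]
  have hx : U.starProjection x ∈ U := U.starProjection_apply_mem x
  generalize U.starProjection x = y at hx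
  have hy : U ≤ (Submodule.comap (T : H →ₗ[ℂ] H) Uᗮ) := by
    refine Submodule.span_le.2 ?_
    rintro _ ⟨j, rfl⟩
    change T (w j) ∈ Uᗮ
    rw [Submodule.mem_orthogonal]
    intro z hz
    induction hz using Submodule.span_induction with
    | mem z hz => obtain ⟨i, rfl⟩ := hz; exact hT i j
    | zero => simp
    | add a b _ _ ha hb => rw [inner_add_left, ha, hb, add_zero]
    | smul c a _ ha => rw [inner_smul_left, ha, mul_zero]
  exact hy hx

/-! ### From a symmetry to a commutator -/

section Symmetry

variable {H : Type v} [NormedAddCommGroup H] [InnerProductSpace ℂ H] [CompleteSpace H]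

/-- If a projection `P` and a symmetry `J` satisfy `PJP = 0`, then `Z = PJ - JP` is a
skew-adjoint partial isometry that intertwines `P` and `1 - P`. -/
theorem commutator_symmetry_properties {P J : H →L[ℂ] H} (hP : IsStarProjection P)
    (hJ : star J = J) (hJJ : J * J = 1) (hPJP : P * J * P = 0) :
    star (P * J - J * P) = -(P * J - J * P) ∧ ‖P * J - J * P‖ ≤ 1 ∧
      P * (P * J - J * P) = (P * J - J * P) * (1 - P) := by
  have hPs : star P = P := hP.isSelfAdjoint
  have hPP : P * P = P := hP.isIdempotentElem
  have hPP' : ∀ X, P * (P * X) = P * X := fun X => by rw [← mul_assoc, hPP]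
  have hJJ' : ∀ X, J * (J * X) = X := fun X => by rw [← mul_assoc, hJJ, one_mul]
  have h0 : P * (J * P) = 0 := by rw [← mul_assoc, hPJP]
  have h0' : ∀ X, P * (J * (P * X)) = 0 := fun X => by
    rw [← mul_assoc J, ← mul_assoc P, h0, zero_mul]
  have hZ : star (P * J - J * P) = -(P * J - J * P) := by
    rw [star_sub, star_mul, star_mul, hPs, hJ, neg_sub]
  refine ⟨hZ, ?_, ?_⟩
  -- Here `Z* Z = P + J P J`, a sum of two orthogonal projections because `PJP = 0`.
  · have hQ : IsStarProjection (star (P * J - J * P) * (P * J - J * P)) := by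
      constructor
      · rw [hZ, IsIdempotentElem]
        simp [mul_sub, sub_mul, mul_add, add_mul, mul_assoc, hPP, hPP', hJJ', h0, h0']
      · exact IsSelfAdjoint.star_mul_self _
    have := hQ.norm_le
    rw [CStarRing.norm_star_mul_self] at this
    nlinarith [norm_nonneg (P * J - J * P)]
  · simp [mul_sub, sub_mul, mul_assoc, hPP, hPP', h0]

/-- On expanding, the two terms containing `PJP` vanish and the other two agree because `J` commutes
with `π a`; the factor `1 / 2` cancels the resulting `2`. -/
theorem commutatorCompression_commutator_symmetry {A : Type u} [CStarAlgebra A]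
    (π : A →⋆ₐ[ℂ] (H →L[ℂ] H)) {P J : H →L[ℂ] H} (hPJP : P * J * P = 0)
    (hP : P * P = P) {a : A} (hJ : J * π a = π a * J) :
    commutatorCompression π P (P * J - J * P) a = P * (J * π a) * P := by
  have hPP' : ∀ X, P * (P * X) = P * X := fun X => by rw [← mul_assoc, hP]
  have h0 : P * (J * P) = 0 := by rw [← mul_assoc, hPJP]
  have h0' : ∀ X, P * (J * (P * X)) = 0 := fun X => by
    rw [← mul_assoc J, ← mul_assoc P, h0, zero_mul]
  have : P * ((P * J - J * P) * π a - π a * (P * J - J * P)) * P = (2 : ℂ) • (P * (J * π a) * P) := by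
    have hJ' : ∀ X, π a * (J * X) = J * (π a * X) := fun X => by rw [← mul_assoc, ← hJ, mul_assoc]
    simp [mul_sub, sub_mul, mul_assoc, hP, hPP', h0, h0', hJ', two_smul]
  change (1 / 2 : ℂ) • (P * ((P * J - J * P) * π a - π a * (P * J - J * P)) * P) = _
  rw [this, smul_smul]
  norm_num

end Symmetry

/-! ### The compression attached to a separating functional -/

/-- A distance estimate for `∑ᵢⱼ eᵢ* ρ(Dᵢⱼ) eⱼ` is attained by a commutator compression that vanishes
on `V`: take the GNS representation of the separating functional on `B × B`, the symmetry
`J = π(1, -1)`, the projection `P` onto the span of the vectors `(eᵢ, eᵢ)`, and `Z = PJ - JP`. -/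
theorem exists_commutatorCompression_of_dist {A : Type u} [CStarAlgebra A] (V : OperatorSystem A)
    {B : Type u} [CStarAlgebra B] (ρ : A →⋆ₐ[ℂ] B) {ι : Type*} [Fintype ι] [DecidableEq ι]
    (e : ι → B) (he : ∑ i, star (e i) * e i = 1) (D : ι → ι → A)
    (hD : IsSelfAdjoint (sandwich ρ e D)) {d : ℝ} (hd : 0 < d)
    (hdist : ∀ t : ℝ, ∀ s : ι → ι → A, (∀ i j, s i j ∈ V.toSubmodule) →
      |t| * d ≤ ‖t • sandwich ρ e D + sandwich ρ e s‖) :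
    ∃ (H : Type u) (_ : NormedAddCommGroup H) (_ : InnerProductSpace ℂ H) (_ : CompleteSpace H)
      (π : A →⋆ₐ[ℂ] (H →L[ℂ] H)) (P Z : H →L[ℂ] H),
      IsStarProjection P ∧ star Z = -Z ∧ ‖Z‖ ≤ 1 ∧ P * Z = Z * (1 - P) ∧
      (∀ a ∈ V.toSubmodule, commutatorCompression π P Z a = 0) ∧
      ∃ w : ι → H, 0 < ∑ i, ‖w i‖ ^ 2 ∧
        (∑ i, ∑ j, inner ℂ (w i) (commutatorCompression π P Z (D i j) (w j))).re =
          d * ∑ i, ‖w i‖ ^ 2 := by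
  let S : Submodule ℂ B := Submodule.map (sandwich ρ e)
    (Submodule.pi Set.univ fun _ => Submodule.pi Set.univ fun _ => V.toSubmodule)
  have hmem : ∀ s : ι → ι → A, (∀ i j, s i j ∈ V.toSubmodule) → sandwich ρ e s ∈ S :=
    fun s hs => ⟨s, fun i _ j _ => hs i j, rfl⟩
  have hsingle : ∀ a ∈ V.toSubmodule, ∀ i j, star (e i) * ρ a * e j ∈ S := fun a ha i j => by
    rw [← sandwich_single]
    refine hmem _ fun k l => ?_
    by_cases hk : k = i
    · subst hk
      rw [Pi.single_eq_same]
      by_cases hl : l = j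
      · subst hl
        rwa [Pi.single_eq_same]
      · rw [Pi.single_eq_of_ne hl]
        exact zero_mem _
    · rw [Pi.single_eq_of_ne hk]
      exact zero_mem _
  obtain ⟨g, hg, hg1, hgS, hgD⟩ := exists_positive_functional_of_dist S
    (by
      rintro _ ⟨s, hs, rfl⟩
      rw [star_sandwich]
      exact hmem _ fun i j => V.star_mem' (hs j trivial i trivial))
    hD hd
    (by
      rintro t _ ⟨s, hs, rfl⟩
      exact hdist t s fun i j => hs i trivial j trivial)
  obtain ⟨H, i1, i2, i3, σ, η, hη, hση⟩ := exists_gns_representation g hg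
  let π : A →⋆ₐ[ℂ] (H →L[ℂ] H) := σ.comp (ρ.prod ρ)
  have hπ : ∀ a, π a = σ (ρ a, ρ a) := fun a => rfl
  let J : H →L[ℂ] H := σ (1, -1)
  let w : ι → H := fun i => η (e i, e i)
  have : FiniteDimensional ℂ (Submodule.span ℂ (Set.range w)) :=
    FiniteDimensional.span_of_finite ℂ (Set.finite_range w)
  let P := (Submodule.span ℂ (Set.range w)).starProjection
  have hP : IsStarProjection P := isStarProjection_starProjection
  have hPw : ∀ i, P (w i) = w i := fun i =>
    Submodule.starProjection_eq_self_iff.2 (Submodule.subset_span ⟨i, rfl⟩)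
  have hJ : star J = J := by
    rw [← map_star]
    simp [J, Prod.star_def]
  have hJJ : J * J = 1 := by
    rw [← map_mul]
    simp [Prod.mk_mul_mk, ← Prod.one_eq_mk]
  have hJπ : ∀ a, J * π a = σ (ρ a, -ρ a) := fun a => by
    rw [hπ, ← map_mul]
    simp
  have hcomm : ∀ a, J * π a = π a * J := fun a => by
    rw [hJπ, hπ, ← map_mul]
    simp
  have hinner : ∀ a i j, inner ℂ (w i) ((J * π a) (w j)) =
      g (star (e i) * ρ a * e j, -(star (e i) * ρ a * e j)) := fun a i j => by
    rw [hJπ, hση, hη]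
    simp [Prod.star_def, mul_assoc]
  have hcompress : ∀ a ∈ V.toSubmodule, P * (J * π a) * P = 0 := fun a ha =>
    starProjection_span_mul_mul_eq_zero w _ fun i j => by
      rw [hinner]
      exact hgS _ (hsingle a ha i j)
  -- This is where `V` must contain the identity.
  have hPJP : P * J * P = 0 := by
    simpa using hcompress 1 V.one_mem'
  have hΨ : ∀ a, commutatorCompression π P (P * J - J * P) a = P * (J * π a) * P := fun a =>
    commutatorCompression_commutator_symmetry π hPJP hP.isIdempotentElem (hcomm a)
  obtain ⟨h1, h2, h3⟩ := commutator_symmetry_properties hP hJ hJJ hPJP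
  -- The normalisation `∑ eᵢ* eᵢ = 1` turns the total mass of the vectors into `g 1`.
  have hsum : ∑ i, ‖w i‖ ^ 2 = (g 1).re := by
    have : (1 : B × B) = ∑ i, star ((e i, e i) : B × B) * (e i, e i) := by
      apply Prod.ext <;> simp [Prod.fst_sum, Prod.snd_sum, he]
    rw [this, map_sum, Complex.re_sum]
    refine Finset.sum_congr rfl fun i _ => ?_
    rw [← hη, inner_self_eq_norm_sq_to_K]
    norm_cast
  refine ⟨H, i1, i2, i3, π, P, P * J - J * P, hP, h1, h2, h3, fun a ha => ?_, w, ?_, ?_⟩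
  · rw [hΨ, hcompress a ha]
  · rwa [hsum]
  · rw [hsum, ← hgD]
    congr 1
    have : ((sandwich ρ e D, -sandwich ρ e D) : B × B) =
        ∑ i, ∑ j, (star (e i) * ρ (D i j) * e j, -(star (e i) * ρ (D i j) * e j)) := by
      apply Prod.ext <;> simp [Prod.fst_sum, Prod.snd_sum, sandwich_apply]
    rw [this, map_sum]
    refine Finset.sum_congr rfl fun i _ => ?_
    rw [map_sum]
    refine Finset.sum_congr rfl fun j _ => ?_
    rw [hΨ, ← hinner]
    change inner ℂ (w i) (P ((J * π (D i j)) (P (w j)))) = _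
    rw [hPw, ← Submodule.inner_starProjection_left_eq_right]
    change inner ℂ (P (w i)) _ = _
    rw [hPw]

/-! ### Norm estimates in matrix algebras -/

theorem CStarAlgebra.exists_norm_sq_smul_one_sub {C : Type u} [CStarAlgebra C] (t : C) :
    ∃ s : C, ((‖t‖ ^ 2 : ℝ) : ℂ) • (1 : C) - star t * t = star s * s := by
  let := CStarAlgebra.spectralOrder C
  have := CStarAlgebra.spectralOrderedRing C
  refine CStarAlgebra.nonneg_iff_eq_star_mul_self.1 (sub_nonneg.2 ?_)
  have := CStarAlgebra.star_mul_le_algebraMap_norm_sq (a := t)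
  rwa [Algebra.algebraMap_eq_smul_one, ← Complex.coe_smul] at this

namespace CStarMatrix

/-- The `*`-homomorphism sending `x` to the diagonal matrix with all diagonal entries `x`. -/
def scalarStarAlgHom (κ : Type*) [Fintype κ] [DecidableEq κ] (X : Type*) [Semiring X] [StarRing X]
    [Algebra ℂ X] : X →⋆ₐ[ℂ] CStarMatrix κ κ X where
  toFun x := ofMatrix (Matrix.diagonal fun _ => x)
  map_one' := by
    ext i j
    rw [one_apply]
    exact Matrix.diagonal_apply ..
  map_mul' x y := by
    change _ = ofMatrix (Matrix.diagonal (fun _ => x) * Matrix.diagonal fun _ => y)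
    rw [Matrix.diagonal_mul_diagonal]
  map_zero' := by
    ext i j
    simp
  map_add' x y := by
    ext i j
    simp [Matrix.diagonal_apply]
    split_ifs <;> simp
  commutes' c := by
    ext i j
    simp [algebraMap_apply, Matrix.diagonal_apply]
  map_star' x := by
    change _ = ofMatrix (Matrix.diagonal fun _ => x).conjTranspose
    rw [Matrix.diagonal_conjTranspose]
    rfl

theorem star_single_mul_mul_single {κ : Type*} [Fintype κ] [DecidableEq κ] {X : Type*} [Semiring X]
    [StarRing X] (o i j : κ) (x y : X) (M : CStarMatrix κ κ X) :
    star (ofMatrix (Matrix.single o i x)) * M * ofMatrix (Matrix.single o j y) =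
      ofMatrix (Matrix.single i j (star x * M o o * y)) := by
  change ofMatrix ((Matrix.single o i x).conjTranspose * (ofMatrix.symm M) * Matrix.single o j y) = _
  rw [Matrix.conjTranspose_single, Matrix.single_mul_mul_single]
  rfl

section Commutator

variable {A : Type u} [CStarAlgebra A] [PartialOrder A] [StarOrderedRing A]
  {X : Type v} [CStarAlgebra X] [PartialOrder X] [StarOrderedRing X]
  {κ : Type*} [Fintype κ] [DecidableEq κ]

theorem norm_map_commutator_compression_le (π : A →⋆ₐ[ℂ] X) {P Z : X} (hP : ‖P‖ ≤ 1)
    (hZ : ‖Z‖ ≤ 1) (C : Matrix κ κ A) :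
    ‖(ofMatrix (C.map fun a => (1 / 2 : ℂ) • (P * (Z * π a - π a * Z) * P)) : CStarMatrix κ κ X)‖ ≤
      ‖(ofMatrix C : CStarMatrix κ κ A)‖ := by
  set p : CStarMatrix κ κ X := scalarStarAlgHom κ X P with hp
  set z : CStarMatrix κ κ X := scalarStarAlgHom κ X Z with hz
  set c : CStarMatrix κ κ X := mapₙₐ (π : A →⋆ₙₐ[ℂ] X) (ofMatrix C) with hc
  have hp1 : ‖p‖ ≤ 1 := (NonUnitalStarAlgHom.norm_apply_le (scalarStarAlgHom κ X) P).trans hP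
  have hz1 : ‖z‖ ≤ 1 := (NonUnitalStarAlgHom.norm_apply_le (scalarStarAlgHom κ X) Z).trans hZ
  have hc1 : ‖c‖ ≤ ‖(ofMatrix C : CStarMatrix κ κ A)‖ := NonUnitalStarAlgHom.norm_apply_le _ _
  have key : (ofMatrix (C.map fun a => (1 / 2 : ℂ) • (P * (Z * π a - π a * Z) * P)) :
      CStarMatrix κ κ X) = (1 / 2 : ℂ) • (p * (z * c - c * z) * p) := by
    change ofMatrix _ = ofMatrix ((1 / 2 : ℂ) • (Matrix.diagonal (fun _ => P) *
      (Matrix.diagonal (fun _ => Z) * C.map π - C.map π * Matrix.diagonal (fun _ => Z)) *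
      Matrix.diagonal (fun _ => P)))
    congr 1
    ext i j
    simp [Matrix.diagonal_mul, Matrix.mul_diagonal]
  rw [key, norm_smul]
  have h1 : ‖z * c - c * z‖ ≤ 2 * ‖c‖ := by
    refine (norm_sub_le _ _).trans ?_
    have h2 := norm_mul_le z c
    have h3 := norm_mul_le c z
    nlinarith [norm_nonneg c]
  have h2 : ‖p * (z * c - c * z) * p‖ ≤ 2 * ‖c‖ := by
    calc _ ≤ ‖p‖ * ‖z * c - c * z‖ * ‖p‖ := (norm_mul_le _ _).trans (by gcongr; exact norm_mul_le _ _)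
      _ ≤ 1 * (2 * ‖c‖) * 1 := by gcongr
      _ = _ := by ring
  norm_num
  linarith

end Commutator

section Operators

variable {H : Type v} [NormedAddCommGroup H] [InnerProductSpace ℂ H] [CompleteSpace H]
  {κ : Type*} [Fintype κ]

theorem sum_inner_star_mul_self (S : CStarMatrix κ κ (H →L[ℂ] H)) (w : κ → H) :
    ∑ i, ∑ j, inner ℂ (w i) ((star S * S) i j (w j)) =
      ((∑ k, ‖∑ j, S k j (w j)‖ ^ 2 : ℝ) : ℂ) := by
  have h : ∀ k, ((‖∑ j, S k j (w j)‖ ^ 2 : ℝ) : ℂ) =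
      ∑ i, ∑ j, inner ℂ (w i) ((star (S k i) * S k j) (w j)) := fun k => by
    have : ((‖∑ j, S k j (w j)‖ ^ 2 : ℝ) : ℂ) =
        inner ℂ (∑ j, S k j (w j)) (∑ j, S k j (w j)) := by
      rw [inner_self_eq_norm_sq_to_K]
      norm_cast
    rw [this, sum_inner]
    refine Finset.sum_congr rfl fun i _ => ?_
    rw [inner_sum]
    refine Finset.sum_congr rfl fun j _ => ?_
    rw [ContinuousLinearMap.star_eq_adjoint]
    exact (ContinuousLinearMap.adjoint_inner_right _ _ _).symm
  rw [Complex.ofReal_sum]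
  simp only [h]
  symm
  rw [Finset.sum_comm]
  refine Finset.sum_congr rfl fun i _ => ?_
  rw [Finset.sum_comm]
  refine Finset.sum_congr rfl fun j _ => ?_
  symm
  rw [mul_apply, sum_apply, inner_sum]
  rfl

/-- Pairing `‖T‖² - T* T = S* S` with `w` gives `∑ ‖(S w)ₖ‖² ≥ 0`. This bounds the action on `H^κ`
using only the C*-norm of `T`. -/
theorem sum_norm_sq_mulVec_le [PartialOrder (H →L[ℂ] H)] [StarOrderedRing (H →L[ℂ] H)]
    [DecidableEq κ] (T : CStarMatrix κ κ (H →L[ℂ] H)) (w : κ → H) :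
    ∑ k, ‖∑ j, T k j (w j)‖ ^ 2 ≤ ‖T‖ ^ 2 * ∑ k, ‖w k‖ ^ 2 := by
  obtain ⟨S, hS⟩ := CStarAlgebra.exists_norm_sq_smul_one_sub T
  have h1 := sum_inner_star_mul_self S w
  rw [← hS] at h1
  have h2 : ∑ i, ∑ j, inner ℂ (w i)
      ((((‖T‖ ^ 2 : ℝ) : ℂ) • (1 : CStarMatrix κ κ (H →L[ℂ] H)) - star T * T) i j (w j)) =
      ((‖T‖ ^ 2 * ∑ k, ‖w k‖ ^ 2 : ℝ) : ℂ) -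
        ∑ i, ∑ j, inner ℂ (w i) ((star T * T) i j (w j)) := by
    rw [Finset.mul_sum, Complex.ofReal_sum, ← Finset.sum_sub_distrib]
    refine Finset.sum_congr rfl fun i _ => ?_
    have h3 : ∀ j, inner ℂ (w i)
        ((((‖T‖ ^ 2 : ℝ) : ℂ) • (1 : CStarMatrix κ κ (H →L[ℂ] H)) - star T * T) i j (w j)) =
        (if i = j then ((‖T‖ ^ 2 * ‖w i‖ ^ 2 : ℝ) : ℂ) else 0) -
          inner ℂ (w i) ((star T * T) i j (w j)) := fun j => by
      rw [sub_apply, _root_.sub_apply, inner_sub_right]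
      congr 1
      rw [smul_apply, one_apply]
      split_ifs with hij
      · subst hij
        rw [_root_.smul_apply, one_apply_eq_self, inner_smul_right,
          inner_self_eq_norm_sq_to_K]
        simp
      · simp
    simp only [h3, Finset.sum_sub_distrib, Finset.sum_ite_eq, Finset.mem_univ, if_true]
  rw [h2, sum_inner_star_mul_self, ← Complex.ofReal_sub, Complex.ofReal_inj] at h1
  have : 0 ≤ ∑ k, ‖∑ j, S k j (w j)‖ ^ 2 := by positivity
  linarith

/-- Cauchy–Schwarz and the arithmetic–geometric mean inequality, multiplied through by `‖T‖`. The
unnormalised form matches the norming identity, which controls only the sum of the two squared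
lengths. -/
theorem re_sum_inner_le [PartialOrder (H →L[ℂ] H)] [StarOrderedRing (H →L[ℂ] H)]
    [DecidableEq κ] (T : CStarMatrix κ κ (H →L[ℂ] H)) (v w : κ → H) :
    2 * (∑ i, ∑ j, inner ℂ (v i) (T i j (w j))).re ≤
      ‖T‖ * (∑ i, ‖v i‖ ^ 2 + ∑ i, ‖w i‖ ^ 2) := by
  have h1 := sum_norm_sq_mulVec_le T w
  have h2 : ∀ i, 2 * ‖T‖ * (∑ j, inner ℂ (v i) (T i j (w j))).re ≤
      ‖T‖ ^ 2 * ‖v i‖ ^ 2 + ‖∑ j, T i j (w j)‖ ^ 2 := fun i => by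
    rw [← inner_sum]
    have h3 := re_inner_le_norm (𝕜 := ℂ) (v i) (∑ j, T i j (w j))
    have h4 : (inner ℂ (v i) (∑ j, T i j (w j))).re ≤ ‖v i‖ * ‖∑ j, T i j (w j)‖ := h3
    have h5 := mul_le_mul_of_nonneg_left h4 (norm_nonneg T)
    nlinarith [sq_nonneg (‖T‖ * ‖v i‖ - ‖∑ j, T i j (w j)‖)]
  have h3 := Finset.sum_le_sum fun i (_ : i ∈ Finset.univ) => h2 i
  rw [← Finset.mul_sum, ← Complex.re_sum, Finset.sum_add_distrib, ← Finset.mul_sum] at h3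
  rcases (norm_nonneg T).eq_or_lt with h0 | h0
  · have hT : T = 0 := norm_eq_zero.1 h0.symm
    simp [hT]
  · refine le_of_mul_le_mul_left ?_ h0
    nlinarith
end Operators

end CStarMatrix

/-! ### Hilbert sums of representations and compressions -/

namespace lp

open scoped ENNReal

variable {I : Type u} {H : I → Type v} [∀ i, NormedAddCommGroup (H i)]
  [∀ i, InnerProductSpace ℂ (H i)]

theorem mapCLM_eq_of_apply {T : ∀ i, H i →L[ℂ] H i} {K : ℝ} {hK : 0 ≤ K}
    {hT : ∀ i, ‖T i‖ ≤ K} {S : lp H 2 →L[ℂ] lp H 2} (h : ∀ f i, S f i = T i (f i)) :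
    mapCLM 2 T hK hT = S := by
  ext f i
  rw [h]
  rfl

variable [∀ i, CompleteSpace (H i)]

theorem star_mapCLM {T : ∀ i, H i →L[ℂ] H i} {K : ℝ} (hK : 0 ≤ K) (hT : ∀ i, ‖T i‖ ≤ K)
    (hT' : ∀ i, ‖star (T i)‖ ≤ K) :
    star (mapCLM 2 T hK hT) = mapCLM 2 (fun i => star (T i)) hK hT' := by
  rw [ContinuousLinearMap.star_eq_adjoint, eq_comm, ContinuousLinearMap.eq_adjoint_iff]
  intro f g
  rw [inner_eq_tsum, inner_eq_tsum]
  refine tsum_congr fun i => ?_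
  exact ContinuousLinearMap.adjoint_inner_left _ _ _

/-- The direct sum of a family of representations of a C*-algebra. -/
noncomputable def directSumRep {A : Type*} [CStarAlgebra A]
    (π : ∀ i, A →⋆ₐ[ℂ] (H i →L[ℂ] H i)) : A →⋆ₐ[ℂ] (lp H 2 →L[ℂ] lp H 2) where
  toFun a := mapCLM 2 (fun i => π i a) (norm_nonneg a)
    fun i => NonUnitalStarAlgHom.norm_apply_le (π i) a
  map_one' := mapCLM_eq_of_apply fun f i => by simp
  map_mul' a b := mapCLM_eq_of_apply fun f i => by
    rw [map_mul]
    rfl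
  map_zero' := mapCLM_eq_of_apply fun f i => by simp
  map_add' a b := mapCLM_eq_of_apply fun f i => by
    rw [map_add]
    rfl
  commutes' c := mapCLM_eq_of_apply fun f i => by
    simp [Algebra.algebraMap_eq_smul_one]
  map_star' a := by
    rw [star_mapCLM (hT' := fun i => by
      rw [norm_star]
      exact NonUnitalStarAlgHom.norm_apply_le (π i) a)]
    refine mapCLM_eq_of_apply fun f i => ?_
    rw [map_star]
    rfl

end lp

/-- Commutator compressions can be added up to a single one on the Hilbert sum. -/
theorem exists_directSum_commutatorCompression {A : Type u} [CStarAlgebra A] {I : Type u}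
    [DecidableEq I] {H : I → Type u} [∀ i, NormedAddCommGroup (H i)]
    [∀ i, InnerProductSpace ℂ (H i)] [∀ i, CompleteSpace (H i)]
    (π : ∀ i, A →⋆ₐ[ℂ] (H i →L[ℂ] H i)) (P Z : ∀ i, H i →L[ℂ] H i)
    (hP : ∀ i, IsStarProjection (P i)) (hZ : ∀ i, star (Z i) = -Z i) (hZ1 : ∀ i, ‖Z i‖ ≤ 1)
    (hPZ : ∀ i, P i * Z i = Z i * (1 - P i)) :
    ∃ (K : Type u) (_ : NormedAddCommGroup K) (_ : InnerProductSpace ℂ K) (_ : CompleteSpace K)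
      (σ : A →⋆ₐ[ℂ] (K →L[ℂ] K)) (Q Y : K →L[ℂ] K),
      IsStarProjection Q ∧ star Y = -Y ∧ ‖Y‖ ≤ 1 ∧ Q * Y = Y * (1 - Q) ∧
      (∀ a, (∀ i, commutatorCompression (π i) (P i) (Z i) a = 0) →
        commutatorCompression σ Q Y a = 0) ∧
      ∀ i, ∃ j : H i →ₗᵢ[ℂ] K, ∀ a x,
        commutatorCompression σ Q Y a (j x) =
          j (commutatorCompression (π i) (P i) (Z i) a x) := by
  have hP1 : ∀ i, ‖P i‖ ≤ 1 := fun i => (hP i).norm_le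
  let Q := lp.mapCLM 2 P zero_le_one hP1
  let Y := lp.mapCLM 2 Z zero_le_one hZ1
  have hQ : ∀ f i, Q f i = P i (f i) := fun f i => rfl
  have hY : ∀ f i, Y f i = Z i (f i) := fun f i => rfl
  have hΨ : ∀ a f i, commutatorCompression (lp.directSumRep π) Q Y a f i =
      commutatorCompression (π i) (P i) (Z i) a (f i) := fun a f i => rfl
  refine ⟨lp H 2, inferInstance, inferInstance, inferInstance, lp.directSumRep π, Q, Y,
    ⟨?_, ?_⟩, ?_, lp.norm_mapCLM_le 2 Z zero_le_one hZ1, ?_, fun a ha => ?_, fun i =>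
      ⟨⟨lp.lsingle (𝕜 := ℂ) 2 i, fun x => lp.norm_single (by norm_num) i x⟩, fun a x => ?_⟩⟩
  · ext f i
    exact congrArg (fun T => T (f i)) (hP i).isIdempotentElem
  · rw [IsSelfAdjoint, lp.star_mapCLM (hT' := fun i => by rw [norm_star]; exact hP1 i)]
    refine lp.mapCLM_eq_of_apply fun f i => ?_
    rw [(hP i).isSelfAdjoint.star_eq]
    rfl
  · rw [lp.star_mapCLM (hT' := fun i => by rw [norm_star]; exact hZ1 i)]
    refine lp.mapCLM_eq_of_apply fun f i => ?_
    rw [hZ i]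
    rfl
  · ext f i
    exact congrArg (fun T => T (f i)) (hPZ i)
  · ext f i
    rw [hΨ, ha i]
    rfl
  · ext k
    rw [hΨ]
    change commutatorCompression (π k) (P k) (Z k) a (lp.single 2 i x k) =
      lp.single 2 i (commutatorCompression (π i) (P i) (Z i) a x) k
    by_cases hk : k = i
    · subst hk
      simp
    · rw [lp.single_apply_ne _ _ _ hk, lp.single_apply_ne _ _ _ hk, map_zero]

/-! ### Matrix units in iterated matrix algebras -/

section MatrixUnits

variable {A : Type u} [CStarAlgebra A] [PartialOrder A] [StarOrderedRing A]
  {κ ν : Type} [Fintype κ] [DecidableEq κ] [Fintype ν] [DecidableEq ν]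

open CStarMatrix in
/-- The row of matrix units `e_{(p₀, o), (p, i)}` in `M_κ(M_ν(A))`. -/
def matrixUnitRow (A : Type u) [CStarAlgebra A] (p₀ : κ) (o : ν) (x : κ × ν) :
    CStarMatrix κ κ (CStarMatrix ν ν A) :=
  ofMatrix (Matrix.single p₀ x.1 (ofMatrix (Matrix.single o x.2 1)))

/-- `A` as scalar matrices in `M_κ(M_ν(A))`. -/
noncomputable def iteratedScalar (A : Type u) [CStarAlgebra A] [PartialOrder A] [StarOrderedRing A]
    (κ ν : Type) [Fintype κ] [DecidableEq κ] [Fintype ν] [DecidableEq ν] :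
    A →⋆ₐ[ℂ] CStarMatrix κ κ (CStarMatrix ν ν A) :=
  (CStarMatrix.scalarStarAlgHom κ (CStarMatrix ν ν A)).comp (CStarMatrix.scalarStarAlgHom ν A)

open CStarMatrix in
theorem star_matrixUnitRow_mul_mul (p₀ : κ) (o : ν) (x y : κ × ν) (a : A) :
    star (matrixUnitRow A p₀ o x) * iteratedScalar A κ ν a * matrixUnitRow A p₀ o y =
      ofMatrix (Matrix.single x.1 y.1 (ofMatrix (Matrix.single x.2 y.2 a))) := by
  rw [matrixUnitRow, matrixUnitRow, star_single_mul_mul_single]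
  have : iteratedScalar A κ ν a p₀ p₀ = scalarStarAlgHom ν A a :=
    Matrix.diagonal_apply_eq (fun _ : κ => scalarStarAlgHom ν A a) p₀
  rw [this, star_single_mul_mul_single]
  have : scalarStarAlgHom ν A a o o = a := Matrix.diagonal_apply_eq (fun _ : ν => a) o
  rw [this, star_one, one_mul, mul_one]

-- Since `eₓ* a e_y` is the matrix with single entry `a` at `(x, y)`, the sandwich by matrix units
-- reassembles a matrix from its entries.
open CStarMatrix in
theorem sandwich_matrixUnitRow (p₀ : κ) (o : ν) (c : κ × ν → κ × ν → A) :
    sandwich (iteratedScalar A κ ν) (matrixUnitRow A p₀ o) c =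
      ofMatrix (fun p q => ofMatrix fun i j => c (p, i) (q, j)) := by
  rw [sandwich_apply]
  simp only [star_matrixUnitRow_mul_mul]
  ext p q i j
  let ev : CStarMatrix κ κ (CStarMatrix ν ν A) →+ A :=
    { toFun := fun M => M p q i j
      map_zero' := rfl
      map_add' := fun _ _ => rfl }
  have key : ∀ x y : κ × ν,
      ev (ofMatrix (Matrix.single x.1 y.1 (ofMatrix (Matrix.single x.2 y.2 (c x y))))) =
      if x = (p, i) then (if y = (q, j) then c x y else 0) else 0 := by
    rintro ⟨p', i'⟩ ⟨q', j'⟩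
    change (Matrix.single p' q' (Matrix.single i' j' (c (p', i') (q', j')))) p q i j = _
    rw [Matrix.single_apply]
    by_cases h1 : p' = p
    · by_cases h2 : q' = q
      · rw [if_pos ⟨h1, h2⟩, Matrix.single_apply]
        simp [h1, h2, ite_and]
      · simp [h2]
    · simp [h1]
  refine (map_sum ev _ _).trans ((Finset.sum_congr rfl fun x _ => (map_sum ev _ _).trans
    (Finset.sum_congr rfl fun y _ => key x y)).trans ?_)
  change _ = c (p, i) (q, j)
  simp

theorem sum_star_matrixUnitRow_mul (p₀ : κ) (o : ν) :
    ∑ x, star (matrixUnitRow A p₀ o x) * matrixUnitRow A p₀ o x = 1 := by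
  have h := sandwich_matrixUnitRow p₀ o fun x y : κ × ν => if x = y then (1 : A) else 0
  have h1 : sandwich (iteratedScalar A κ ν) (matrixUnitRow A p₀ o)
      (fun x y : κ × ν => if x = y then (1 : A) else 0) =
      ∑ x, star (matrixUnitRow A p₀ o x) * matrixUnitRow A p₀ o x := by
    rw [sandwich_apply]
    refine Finset.sum_congr rfl fun x _ => ?_
    rw [Finset.sum_eq_single x]
    · simp
    · intro y _ hy
      simp [hy.symm]
    · simp
  rw [← h1, h]
  ext p q i j
  rw [CStarMatrix.one_apply]
  change (if (p, i) = (q, j) then (1 : A) else 0) = _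
  by_cases hpq : p = q
  · simp [hpq, CStarMatrix.one_apply]
  · simp [hpq]

end MatrixUnits

theorem star_commutatorCompression {A : Type u} [CStarAlgebra A] {H : Type v}
    [NormedAddCommGroup H] [InnerProductSpace ℂ H] [CompleteSpace H]
    (π : A →⋆ₐ[ℂ] (H →L[ℂ] H)) {P Z : H →L[ℂ] H} (hP : IsStarProjection P) (hZ : star Z = -Z)
    (a : A) : commutatorCompression π P Z (star a) = star (commutatorCompression π P Z a) := by
  change (1 / 2 : ℂ) • (P * (Z * π (star a) - π (star a) * Z) * P) =
    star ((1 / 2 : ℂ) • (P * (Z * π a - π a * Z) * P))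
  rw [star_smul, star_mul, star_mul, star_sub, star_mul, star_mul, hZ, hP.isSelfAdjoint.star_eq,
    map_star]
  congr 1
  · simp
  · noncomm_ring

/-! ### Norming a single matrix -/

section Norming

variable {A : Type u} [CStarAlgebra A]

/-- The self-adjoint block matrix with corners `C` and `C*`. -/
def offDiagonal {ν : Type} (C : Matrix ν ν A) (x y : Fin 2 × ν) : A :=
  (![![0, C x.2 y.2], ![star (C y.2 x.2), 0]] : Fin 2 → Fin 2 → A) x.1 y.1

theorem star_offDiagonal {ν : Type} (C : Matrix ν ν A) (x y : Fin 2 × ν) :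
    star (offDiagonal C y x) = offDiagonal C x y := by
  obtain ⟨p, i⟩ := x
  obtain ⟨q, j⟩ := y
  fin_cases p <;> fin_cases q <;> simp [offDiagonal]

theorem OperatorSystem.quotientMatrixNorm_le (V : OperatorSystem A) {n : ℕ}
    {C D : Matrix (Fin n) (Fin n) A} (h : D.map V.toSubmodule.mkQ = C.map V.toSubmodule.mkQ) :
    V.quotientMatrixNorm n (C.map V.toSubmodule.mkQ) ≤ cstarMatrixNorm A n D := by
  refine csInf_le ⟨0, ?_⟩ ⟨D, h, rfl⟩
  rintro _ ⟨E, _, rfl⟩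
  let := CStarAlgebra.spectralOrder A
  have := CStarAlgebra.spectralOrderedRing A
  exact norm_nonneg (CStarMatrix.ofMatrix E : CStarMatrix (Fin n) (Fin n) A)

/-- The quotient norm of a single matrix is attained by a commutator compression that vanishes
on `V`. -/
theorem exists_norming_commutatorCompression (V : OperatorSystem A) {n : ℕ}
    (C : Matrix (Fin n) (Fin n) A)
    (hC : 0 < V.quotientMatrixNorm n (C.map V.toSubmodule.mkQ)) :
    ∃ (H : Type u) (_ : NormedAddCommGroup H) (_ : InnerProductSpace ℂ H) (_ : CompleteSpace H)
      (π : A →⋆ₐ[ℂ] (H →L[ℂ] H)) (P Z : H →L[ℂ] H),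
      IsStarProjection P ∧ star Z = -Z ∧ ‖Z‖ ≤ 1 ∧ P * Z = Z * (1 - P) ∧
      (∀ a ∈ V.toSubmodule, commutatorCompression π P Z a = 0) ∧
      ∃ v w : Fin n → H, 0 < ∑ i, ‖v i‖ ^ 2 + ∑ i, ‖w i‖ ^ 2 ∧
        2 * (∑ i, ∑ j, inner ℂ (v i) (commutatorCompression π P Z (C i j) (w j))).re =
          V.quotientMatrixNorm n (C.map V.toSubmodule.mkQ) *
            (∑ i, ‖v i‖ ^ 2 + ∑ i, ‖w i‖ ^ 2) := by
  let := CStarAlgebra.spectralOrder A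
  have := CStarAlgebra.spectralOrderedRing A
  set d := V.quotientMatrixNorm n (C.map V.toSubmodule.mkQ) with hd
  have hdle : ∀ s : Matrix (Fin n) (Fin n) A, (∀ i j, s i j ∈ V.toSubmodule) →
      d ≤ ‖(CStarMatrix.ofMatrix (C + s) : CStarMatrix (Fin n) (Fin n) A)‖ := fun s hs =>
    V.quotientMatrixNorm_le (by
      ext i j
      simp [(Submodule.Quotient.mk_eq_zero _).2 (hs i j)])
  have hn : n ≠ 0 := by
    rintro rfl
    have h0 := hdle 0 fun i => i.elim0
    have : (CStarMatrix.ofMatrix (C + 0) : CStarMatrix (Fin 0) (Fin 0) A) = 0 := by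
      ext i
      exact i.elim0
    rw [this, norm_zero] at h0
    linarith
  let o : Fin n := ⟨0, Nat.pos_of_ne_zero hn⟩
  obtain ⟨H, i1, i2, i3, π, P, Z, hP, hZ, hZ1, hPZ, hV, u, hu, huD⟩ :=
    exists_commutatorCompression_of_dist V (iteratedScalar A (Fin 2) (Fin n))
      (matrixUnitRow A 0 o) (sum_star_matrixUnitRow_mul 0 o) (offDiagonal C)
      (by
        rw [IsSelfAdjoint, star_sandwich]
        congr 1
        ext x y
        exact star_offDiagonal C x y)
      hC
      (by
        intro t s hs
        rw [sandwich_matrixUnitRow, sandwich_matrixUnitRow]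
        -- The corner block `t C + s₀₁` already has norm at least `|t| d`; iterating matrix algebras
        -- makes this block an entry.
        refine le_trans ?_ (CStarMatrix.norm_entry_le_norm (i := 0) (j := 1))
        change |t| * d ≤ ‖(CStarMatrix.ofMatrix (t • C + Matrix.of fun i j => s (0, i) (1, j)) :
          CStarMatrix (Fin n) (Fin n) A)‖
        rcases eq_or_ne t 0 with rfl | ht
        · simp
        · have h1 := hdle (t⁻¹ • Matrix.of fun i j => s (0, i) (1, j)) fun i j =>
            (V.toSubmodule.restrictScalars ℝ).smul_mem _ (hs _ _)
          have h2 : (CStarMatrix.ofMatrix (t • C + Matrix.of fun i j => s (0, i) (1, j)) :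
              CStarMatrix (Fin n) (Fin n) A) = (t : ℂ) • CStarMatrix.ofMatrix
                (C + t⁻¹ • Matrix.of fun i j => s (0, i) (1, j)) := by
            ext i j
            simp [smul_smul, ht]
          rw [h2, norm_smul, Complex.norm_real, Real.norm_eq_abs]
          gcongr)
  have hsum : ∑ x, ‖u x‖ ^ 2 = ∑ i, ‖u (0, i)‖ ^ 2 + ∑ i, ‖u (1, i)‖ ^ 2 := by
    rw [Fintype.sum_prod_type, Fin.sum_univ_two]
  refine ⟨H, i1, i2, i3, π, P, Z, hP, hZ, hZ1, hPZ, hV, fun i => u (0, i), fun i => u (1, i),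
    hsum ▸ hu, ?_⟩
  rw [← hsum, ← huD]
  -- The two off-diagonal blocks contribute conjugate sums, whence twice the real part.
  have hD : ∑ x, ∑ y, inner ℂ (u x) (commutatorCompression π P Z (offDiagonal C x y) (u y)) =
      ∑ i, ∑ j, inner ℂ (u (0, i)) (commutatorCompression π P Z (C i j) (u (1, j))) +
      star (∑ i, ∑ j, inner ℂ (u (0, i)) (commutatorCompression π P Z (C i j) (u (1, j)))) := by
    simp only [Fintype.sum_prod_type, Fin.sum_univ_two]
    congr 1
    · simp [offDiagonal]
    · simp only [offDiagonal, star_sum]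
      rw [Finset.sum_comm]
      simp only [Matrix.cons_val_zero, Matrix.cons_val_one, map_zero, zero_apply, inner_zero_right,
        Finset.sum_const_zero, add_zero]
      rw [Finset.sum_comm]
      rw [Finset.sum_comm]
      refine Finset.sum_congr rfl fun i _ => Finset.sum_congr rfl fun j _ => ?_
      rw [star_commutatorCompression π hP hZ, ContinuousLinearMap.star_eq_adjoint,
        ContinuousLinearMap.adjoint_inner_right]
      exact (inner_conj_symm _ _).symm
  rw [hD, Complex.add_re, Complex.star_def, Complex.conj_re]
  ring

end Norming

/-! ### Assembling the complete isometry -/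

theorem theorem3p1 (A : Type u) [CStarAlgebra A] (V : OperatorSystem A) :
    ∃ (H : Type u) (_ : NormedAddCommGroup H) (_ : InnerProductSpace ℂ H) (_ : CompleteSpace H)
      (π : A →⋆ₐ[ℂ] (H →L[ℂ] H)) (P Z : H →L[ℂ] H),
      IsStarProjection P ∧ star Z = -Z ∧ ‖Z‖ ≤ 1 ∧ P * Z = Z * (1 - P) ∧
      -- `Ψ = commutatorCompression π P Z` is a `*`-map
      (∀ a : A, commutatorCompression π P Z (star a) = star (commutatorCompression π P Z a)) ∧
      -- and it induces a completely isometric `*`-map `φ` of `A/V` onto a `*`-subspace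
      ∃ φ : V.Quotient →ₗ[ℂ] (H →L[ℂ] H),
        (∀ a : A, φ (V.toSubmodule.mkQ a) = commutatorCompression π P Z a) ∧
        (∀ x : V.Quotient, φ (star x) = star (φ x)) ∧
        (∀ T ∈ LinearMap.range φ, star T ∈ LinearMap.range φ) ∧
        IsCompleteIsometry V.quotientMatrixNorm (cstarMatrixNorm (H →L[ℂ] H)) φ := by
  -- One summand for each matrix, of any size, with positive quotient norm; the others need no lower
  -- bound.
  let I := {C : Σ n : ℕ, Matrix (Fin n) (Fin n) A //
    0 < V.quotientMatrixNorm C.1 (C.2.map V.toSubmodule.mkQ)}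
  have hI : ∀ C : I, _ := fun C => exists_norming_commutatorCompression V C.1.2 C.2
  choose H i1 i2 i3 π P Z hP hZ hZ1 hPZ hV v w hpos hnorm using hI
  classical
  obtain ⟨K, j1, j2, j3, σ, Q, Y, hQ, hY, hY1, hQY, hzero, hsub⟩ :=
    exists_directSum_commutatorCompression π P Z hP hZ hZ1 hPZ
  have hstar := star_commutatorCompression σ hQ hY
  let φ : V.Quotient →ₗ[ℂ] (K →L[ℂ] K) := V.toSubmodule.liftQ (commutatorCompression σ Q Y)
    fun a ha => hzero a fun i => hV i a ha
  have hφ : ∀ a, φ (V.toSubmodule.mkQ a) = commutatorCompression σ Q Y a := fun a =>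
    V.toSubmodule.liftQ_apply _ _
  have hφstar : ∀ x : V.Quotient, φ (star x) = star (φ x) := fun x => by
    obtain ⟨a, rfl⟩ := V.toSubmodule.mkQ_surjective x
    rw [OperatorSystem.star_mkQ, hφ, hφ, hstar]
  refine ⟨K, j1, j2, j3, σ, Q, Y, hQ, hY, hY1, hQY, hstar, φ, hφ, hφstar, ?_, fun n X => ?_⟩
  · rintro _ ⟨x, rfl⟩
    exact ⟨star x, hφstar x⟩
  · obtain ⟨C, rfl⟩ : ∃ C : Matrix (Fin n) (Fin n) A, C.map V.toSubmodule.mkQ = X := by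
      choose f hf using V.toSubmodule.mkQ_surjective
      exact ⟨X.map f, by ext i j; exact hf _⟩
    have hmap : ∀ D : Matrix (Fin n) (Fin n) A, (D.map V.toSubmodule.mkQ).map φ =
        D.map (commutatorCompression σ Q Y) := fun D => by
      ext1 i j
      exact hφ _
    let oA := CStarAlgebra.spectralOrder A
    have oA' := CStarAlgebra.spectralOrderedRing A
    let oK := CStarAlgebra.spectralOrder (K →L[ℂ] K)
    have oK' := CStarAlgebra.spectralOrderedRing (K →L[ℂ] K)
    refine le_antisymm (le_csInf ⟨_, C, rfl, rfl⟩ ?_) ?_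
    · rintro _ ⟨D, hD, rfl⟩
      rw [← hD, hmap]
      exact CStarMatrix.norm_map_commutator_compression_le σ hQ.norm_le hY1 D
    · rw [hmap]
      by_cases hC : 0 < V.quotientMatrixNorm n (C.map V.toSubmodule.mkQ)
      · obtain ⟨j, hj⟩ := hsub ⟨⟨n, C⟩, hC⟩
        have h1 := CStarMatrix.re_sum_inner_le
          (CStarMatrix.ofMatrix (C.map (commutatorCompression σ Q Y)))
          (fun i => j (v ⟨⟨n, C⟩, hC⟩ i)) (fun i => j (w ⟨⟨n, C⟩, hC⟩ i))
        simp only [CStarMatrix.ofMatrix_apply, Matrix.map_apply, hj, j.inner_map_map,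
          j.norm_map] at h1
        rw [hnorm ⟨⟨n, C⟩, hC⟩] at h1
        exact le_of_mul_le_mul_right h1 (hpos ⟨⟨n, C⟩, hC⟩)
      · exact (not_lt.1 hC).trans (norm_nonneg (CStarMatrix.ofMatrix
          (C.map (commutatorCompression σ Q Y)) : CStarMatrix (Fin n) (Fin n) (K →L[ℂ] K)))
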